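/- Let $n\ge 0$, let $\mathbb F=\mathbb Q(q,t)$ and $\mathbb K=\mathbb Q(q,t,a)$ with $q,t,a$ independent variables, and let $\mathcal P_n$ be the set of partitions $\lambda=(\lambda_1\ge\cdots\ge\lambda_n\ge 0)$ with at most $n$ parts, $|\lambda|=\lambda_1+\cdots+\lambda_n$. Put $\tau=(\tau_1,\ldots,\tau_n)$ with $\tau_i=t^{1-i}$ and, for $\mu\in\mathcal P_n$, $$\overline\mu=(q^{\mu_1}\tau_1,\ldots,q^{\mu_n}\tau_n),\qquad \widetilde\mu=(q^{-\mu_n}\tau_1,\ldots,q^{-\mu_1}\tau_n),\qquad \overline\mu^{-1}=(\overline\mu_1^{-1},\ldots,\overline\mu_n^{-1}).$$ For every $\lambda\in\mathcal P_n$ there is exactly one symmetric polynomial $R_\lambda\in\mathbb F[x_1,\ldots,x_n]$ of degree at most $|\lambda|$ such that $R_\lambda(\overline\mu)=0$ for all $\mu\in\mathcal P_n$ with $|\mu|\le|\lambda|$ and $\mu\ne\lambda$, and such that the coefficient of $x^\lambda=x_1^{\lambda_1}\cdots x_n^{\lambda_n}$ in $R_\lambda$ is $1$ (the symmetric interpolation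 Macdonald polynomial). Moreover $R_\lambda(a\tau)\ne 0$ in $\mathbb K$, so that the normalized polynomial $$K^+_\lambda(x)=\frac{R_\lambda(x)}{R_\lambda(a\tau)}\in\mathbb K[x_1,\ldots,x_n]$$ is well defined. Okounkov duality: for all $\lambda,\mu\in\mathcal P_n$, $$K^+_\lambda(a\widetilde\mu)=K^+_\mu(a\widetilde\lambda),$$ and also, in the equivalent form, $$K^+_\lambda\bigl(t^{1-n}a\,\overline\mu^{-1}\bigr)=K^+_\mu\bigl(t^{1-n}a\,\overline\lambda^{-1}\bigr).$$ -/

import Mathlib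

namespace InterpolationMacdonald

/-- The field `𝔽 = ℚ(q, t)` of rational functions in two independent variables. -/
abbrev BaseField : Type := FractionRing (MvPolynomial (Fin 2) ℚ)

/-- The field `𝕂 = ℚ(q, t, a) = 𝔽(a)`. -/
abbrev BigField : Type := RatFunc BaseField

/-- The variable `q` of `𝔽`. -/
noncomputable def q : BaseField :=
  algebraMap (MvPolynomial (Fin 2) ℚ) BaseField (MvPolynomial.X 0)

/-- The variable `t` of `𝔽`. -/
noncomputable def t : BaseField :=
  algebraMap (MvPolynomial (Fin 2) ℚ) BaseField (MvPolynomial.X 1)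

/-- The variable `a` of `𝕂`. -/
noncomputable def a : BigField := RatFunc.X

/-- Partitions with at most `n` parts: weakly decreasing sequences of `n` natural numbers. -/
def Partitions (n : ℕ) : Type := {lam : Fin n → ℕ // Antitone lam}

namespace Partitions

/-- The size `|λ| = λ₁ + ⋯ + λₙ`. -/
def size {n : ℕ} (lam : Partitions n) : ℕ := ∑ i, lam.1 i

end Partitions

/-- The vector `τ = (1, t⁻¹, …, t^(1-n))`; the index `i : Fin n` starts at `0`. -/
noncomputable def tau {n : ℕ} (i : Fin n) : BaseField := t ^ (-(i.val : ℤ))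

/-- The vector with entries `q^(μ_i) τ_i`. -/
noncomputable def bar {n : ℕ} (mu : Partitions n) (i : Fin n) : BaseField :=
  q ^ mu.1 i * tau i

/-- The vector `(q^(-μ_n) τ_1, …, q^(-μ_1) τ_n)`. -/
noncomputable def tilde {n : ℕ} (mu : Partitions n) (i : Fin n) : BaseField :=
  q ^ (-(mu.1 i.rev : ℤ)) * tau i

/-- `R` is a symmetric polynomial over `𝔽` of degree at most `|λ|`, vanishing at all points
`bar μ` with `|μ| ≤ |λ|` and `μ ≠ λ`, whose coefficient of `x^λ` is `1`. -/
structure IsSymInterpolation {n : ℕ} (lam : Partitions n)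
    (R : MvPolynomial (Fin n) BaseField) : Prop where
  symmetric : R.IsSymmetric
  degree_le : R.totalDegree ≤ lam.size
  vanishing : ∀ mu : Partitions n, mu.size ≤ lam.size → mu ≠ lam →
    MvPolynomial.eval (bar mu) R = 0
  coeff_eq_one : MvPolynomial.coeff (Finsupp.equivFunOnFinite.symm lam.1) R = 1

open Classical in
/-- The symmetric interpolation Macdonald polynomial `R_λ(x; q, t) ∈ 𝔽[x]`: the polynomial
with the defining properties above (the value `0` would be taken if there were none). -/
noncomputable def symInterpolation {n : ℕ} (lam : Partitions n) :
    MvPolynomial (Fin n) BaseField :=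
  if h : ∃ R, IsSymInterpolation lam R then h.choose else 0

/-- `R_λ` viewed in `𝕂[x]`. -/
noncomputable def symInterpolationK {n : ℕ} (lam : Partitions n) :
    MvPolynomial (Fin n) BigField :=
  MvPolynomial.map (algebraMap BaseField BigField) (symInterpolation lam)

/-- The point `a y ∈ 𝕂ⁿ` for `y ∈ 𝔽ⁿ`. -/
noncomputable def scaleA {n : ℕ} (y : Fin n → BaseField) (i : Fin n) : BigField :=
  a * algebraMap BaseField BigField (y i)

/-- The normalized polynomial `K⁺_λ(x) = R_λ(x) / R_λ(a τ) ∈ 𝕂[x]`. -/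
noncomputable def Kplus {n : ℕ} (lam : Partitions n) : MvPolynomial (Fin n) BigField :=
  MvPolynomial.C (MvPolynomial.eval (scaleA tau) (symInterpolationK lam))⁻¹ *
    symInterpolationK lam

end InterpolationMacdonald

/-! The proof rests on a `q`-difference operator with a free parameter `u`. Its numerator `shiftSum`
sums over sets `I` of variables: those in `I` are divided by `q` inside `f` and by `t` inside the
Vandermonde determinant. Dividing by the Vandermonde determinant and by `∏ x_i` gives a map on
symmetric polynomials that does not raise the degree (`exists_mul_eq_shiftSum`). At `bar σ` only
those `I` contribute for which `σ - 1_I` is again a partition (`exists_addOn_or_shiftPoly_eq_zero`),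
so the operator respects the vanishing conditions. Hence `R_λ` is an eigenvector, with eigenvalue `∏
(1 + u / bar λ_i)` (`shiftSum_bar`).

The coefficients of the powers of `u` express `e_r(bar λ⁻¹) R_λ(bar σ)` through the values `R_λ(bar
(σ - 1_I))`. Solving downwards from the rectangle `(N^n)` gives `R_λ(bar ρ) = R_λ(bar (N^n)) P_ρ(bar
λ⁻¹)`, with `P_ρ` symmetric, of degree at most `nN - |ρ|` and independent of `λ` (`exists_dual`).

Let `ρ` be the complement of `μ` in the rectangle. Then `P_ρ` has degree at most `|μ|`, and with `λ`
the complement of `κ` it becomes, after rescaling, a polynomial in `bar κ` with the vanishing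
properties of `R_μ`. By uniqueness it is a multiple of `R_μ`, and `λ = 0` fixes the constant. This
is duality at `a = q^N` (`duality_rect`). Both sides, cleared of denominators, are polynomials in
`a` agreeing at infinitely many `q^N`, so duality holds for generic `a`. -/

namespace InterpolationMacdonald

open MvPolynomial

/-! ### Degrees and divisibility by linear forms. -/

section General

variable {σ ρ F : Type*} [Field F]

theorem totalDegree_aeval_le {R : Type*} [CommSemiring R] (v : σ → MvPolynomial ρ R)
    (hv : ∀ i, (v i).totalDegree ≤ 1) (f : MvPolynomial σ R) :
    (aeval v f).totalDegree ≤ f.totalDegree := by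
  conv_lhs => rw [f.as_sum, map_sum]
  refine totalDegree_finsetSum_le fun s hs => ?_
  rw [aeval_monomial, algebraMap_eq]
  refine (totalDegree_mul _ _).trans ?_
  rw [totalDegree_C, zero_add, Finsupp.prod]
  refine (totalDegree_finsetProd _ _).trans (le_trans ?_ (le_totalDegree hs))
  refine Finset.sum_le_sum fun i _ => (totalDegree_pow _ _).trans ?_
  simpa using Nat.mul_le_mul_left (s i) (hv i)

/-- If substituting `p` for the variable `X i` kills `f`, then `X i - p` divides `f`. -/
theorem X_sub_dvd_of_aeval_update [DecidableEq σ] {R : Type*} [CommRing R] (i : σ)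
    (p f : MvPolynomial σ R) (h : aeval (Function.update X i p) f = 0) : X i - p ∣ f := by
  have key : (Ideal.Quotient.mkₐ R (Ideal.span {X i - p})).comp (aeval (Function.update X i p)) =
      Ideal.Quotient.mkₐ R (Ideal.span {X i - p}) := by
    refine MvPolynomial.algHom_ext fun j => ?_
    rw [AlgHom.comp_apply, aeval_X]
    rcases eq_or_ne j i with rfl | hj
    · rw [Function.update_self, eq_comm]
      exact Ideal.Quotient.eq.2 (Ideal.subset_span rfl)
    · rw [Function.update_of_ne hj]
  have := DFunLike.congr_fun key f
  rw [AlgHom.comp_apply, h, map_zero] at this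
  exact Ideal.mem_span_singleton.1 (Ideal.Quotient.eq_zero_iff_mem.1 this.symm)

/-- Pairwise non-proportional linear forms dividing `f` have a product dividing `f`. -/
theorem prod_linear_dvd {ι : Type*} (s : Finset ι) (L : ι → MvPolynomial σ F)
    (hL : ∀ i ∈ s, (L i).totalDegree = 1)
    (hsep : ∀ i ∈ s, ∀ j ∈ s, i ≠ j → ∃ v : σ → F, eval v (L i) = 0 ∧ eval v (L j) ≠ 0)
    (f : MvPolynomial σ F) (hf : ∀ i ∈ s, L i ∣ f) : ∏ i ∈ s, L i ∣ f := by
  refine Finset.prod_dvd_of_isRelPrime (fun i hi j hj hij => ?_) hf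
  have hirr : Irreducible (L i) := by
    refine irreducible_of_totalDegree_eq_one (hL i hi) fun x hx => ?_
    refine isUnit_iff_ne_zero.2 ?_
    rintro rfl
    have : L i = 0 := by ext m; simpa using hx m
    have h1 := hL i hi
    simp [this] at h1
  refine hirr.isRelPrime_iff_not_dvd.2 ?_
  rintro ⟨g, hg⟩
  obtain ⟨v, hv, hv'⟩ := hsep i hi j hj hij
  rw [hg, map_mul, hv, zero_mul] at hv'
  exact hv' rfl

theorem totalDegree_prod_eq_card {ι : Type*} (s : Finset ι) (L : ι → MvPolynomial σ F)
    (hL : ∀ i ∈ s, (L i).totalDegree = 1) : (∏ i ∈ s, L i).totalDegree = s.card := by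
  classical
  induction s using Finset.induction_on with
  | empty => simp
  | insert i s hi ih =>
    have hne : ∀ j ∈ insert i s, L j ≠ 0 := fun j hj h0 => by simpa [h0] using hL j hj
    rw [Finset.prod_insert hi, totalDegree_mul_of_isDomain (hne i (Finset.mem_insert_self i s))
      (Finset.prod_ne_zero_iff.2 fun j hj => hne j (Finset.mem_insert_of_mem hj)),
      hL i (Finset.mem_insert_self i s), ih fun j hj => hL j (Finset.mem_insert_of_mem hj),
      Finset.card_insert_of_notMem hi, add_comm]

theorem totalDegree_X_sub_of_not [DecidableEq σ] (i : σ) (p : MvPolynomial σ F)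
    (hp : p.totalDegree ≤ 1) (hi : coeff (Finsupp.single i 1) p = 0) :
    (X i - p).totalDegree = 1 := by
  refine le_antisymm ((totalDegree_sub _ _).trans (by simpa using hp)) ?_
  have : Finsupp.single i 1 ∈ (X i - p).support := by
    rw [mem_support_iff, coeff_sub, hi, coeff_X]; simp
  simpa using le_totalDegree this

end General

/-! ### The `q`-difference operator on symmetric polynomials. -/

section ShiftOperator

variable {F : Type*} [Field F] {n : ℕ}

/-- The vector whose entry at `i` is multiplied by `c` when `i ∈ I`. -/
def scaleOn {A : Type*} [CommRing A] [Algebra F A] (c : F) (I : Finset (Fin n)) (v : Fin n → A)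
    (i : Fin n) : A :=
  (if i ∈ I then c else 1) • v i

variable {A : Type*} [CommRing A] [Algebra F A]

/-- The summand of `shiftSum` belonging to the set `I` of shifted variables. -/
noncomputable def shiftTerm (u κ b c : F) (f : MvPolynomial (Fin n) F) (v : Fin n → A)
    (I : Finset (Fin n)) : A :=
  (∏ i, if i ∈ I then u • (κ • v i - 1) else v i + algebraMap F A u) *
    (Matrix.vandermonde (scaleOn b I v)).det * aeval (scaleOn c I v) f

/-- The numerator, over the Vandermonde determinant times the product of the variables, of the
`q`-difference operator which acts diagonally on the symmetric interpolation polynomials. -/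
noncomputable def shiftSum (u κ b c : F) (f : MvPolynomial (Fin n) F) (v : Fin n → A) : A :=
  ∑ I : Finset (Fin n), shiftTerm u κ b c f v I

variable (u κ b c : F) (f : MvPolynomial (Fin n) F)

theorem map_det_vandermonde {B : Type*} [CommRing B] [Algebra F B] (φ : A →ₐ[F] B)
    (v : Fin n → A) :
    φ (Matrix.vandermonde v).det = (Matrix.vandermonde fun i => φ (v i)).det := by
  simp [Matrix.det_vandermonde, map_prod]

theorem map_shiftSum {B : Type*} [CommRing B] [Algebra F B] (φ : A →ₐ[F] B) (v : Fin n → A) :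
    φ (shiftSum u κ b c f v) = shiftSum u κ b c f (fun i => φ (v i)) := by
  have hs : ∀ (d : F) I, (fun i => φ (scaleOn d I v i)) = scaleOn d I fun i => φ (v i) := by
    intro d I; funext i; simp only [scaleOn, map_smul]
  rw [shiftSum, shiftSum, map_sum]
  refine Finset.sum_congr rfl fun I _ => ?_
  rw [shiftTerm, shiftTerm, map_mul, map_mul, map_prod, ← hs, ← hs, map_det_vandermonde,
    ← AlgHom.comp_apply, comp_aeval]
  congr 3
  funext i
  split_ifs <;> simp

theorem det_vandermonde_comp_perm (σ : Equiv.Perm (Fin n)) (v : Fin n → A) :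
    (Matrix.vandermonde (fun i => v (σ i))).det =
      ((Equiv.Perm.sign σ : ℤ) : A) * (Matrix.vandermonde v).det := by
  rw [← Matrix.det_permute]; rfl

theorem aeval_comp_perm {f : MvPolynomial (Fin n) F} (hf : f.IsSymmetric)
    (σ : Equiv.Perm (Fin n)) (v : Fin n → A) :
    aeval (fun i => v (σ i)) f = aeval v f := by
  conv_rhs => rw [← hf σ, aeval_rename]
  rfl

theorem shiftSum_comp_perm {f : MvPolynomial (Fin n) F} (hf : f.IsSymmetric)
    (σ : Equiv.Perm (Fin n)) (v : Fin n → A) :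
    shiftSum u κ b c f (fun i => v (σ i)) =
      ((Equiv.Perm.sign σ : ℤ) : A) * shiftSum u κ b c f v := by
  rw [shiftSum, shiftSum, Finset.mul_sum]
  refine Fintype.sum_equiv (Equiv.finsetCongr σ) _ _ fun I => ?_
  have hs : ∀ d : F, scaleOn d I (fun i => v (σ i)) =
      fun i => scaleOn d (Equiv.finsetCongr σ I) v (σ i) := by
    intro d; funext i; simp [scaleOn]
  rw [shiftTerm, shiftTerm, hs, hs, det_vandermonde_comp_perm, aeval_comp_perm hf,
    ← Equiv.prod_comp σ fun i => if i ∈ Equiv.finsetCongr σ I then u • (κ • v i - 1)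
      else v i + algebraMap F A u]
  simp only [Equiv.finsetCongr_apply, Finset.mem_map_equiv, Equiv.symm_apply_apply]
  ring

/-- The sum is antisymmetric, so swapping two equal coordinates gives `S = -S`; characteristic zero
finishes. -/
theorem shiftSum_eq_zero_of_eq [CharZero F] [IsDomain A] {f : MvPolynomial (Fin n) F}
    (hf : f.IsSymmetric) {v : Fin n → A} {i j : Fin n} (hij : i ≠ j) (hv : v i = v j) :
    shiftSum u κ b c f v = 0 := by
  have := shiftSum_comp_perm u κ b c hf (Equiv.swap i j) v
  have hc : (fun k => v (Equiv.swap i j k)) = v := by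
    funext k
    rcases eq_or_ne k i with rfl | hi
    · simp [hv]
    rcases eq_or_ne k j with rfl | hj
    · simp [hv]
    rw [Equiv.swap_apply_of_ne_of_ne hi hj]
  rw [hc, Equiv.Perm.sign_swap hij] at this
  have h0 : CharZero A := charZero_of_injective_algebraMap (algebraMap F A).injective
  refine (mul_eq_zero.1 (?_ : (2 : A) * _ = 0)).resolve_left two_ne_zero
  push_cast at this
  linear_combination this

/-- When `v k = 0`, toggling `k` in `I` only changes the `k`-th factor from `u` to `-u`, so the
terms cancel in pairs. -/
theorem shiftSum_eq_zero_of_zero {v : Fin n → A} {k : Fin n} (hv : v k = 0) :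
    shiftSum u κ b c f v = 0 := by
  refine Finset.sum_involution (fun I _ => symmDiff I {k}) (fun I _ => ?_) (fun I _ _ => ?_)
    (fun I _ => Finset.mem_univ _) (fun I _ => ?_)
  · have hmem : ∀ i, i ≠ k → (i ∈ symmDiff I {k} ↔ i ∈ I) := by
      intro i hi; simp [Finset.mem_symmDiff, hi]
    have hk : k ∈ symmDiff I {k} ↔ k ∉ I := by simp [Finset.mem_symmDiff]
    have hs : ∀ d : F, scaleOn d (symmDiff I {k}) v = scaleOn d I v := by
      intro d; funext i
      rcases eq_or_ne i k with rfl | hi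
      · simp [scaleOn, hv]
      · simp [scaleOn, hmem i hi]
    rw [shiftTerm, shiftTerm, hs, hs, ← add_mul, ← add_mul,
      ← Finset.mul_prod_erase _ _ (Finset.mem_univ k),
      ← Finset.mul_prod_erase (a := k) _ (fun i => if i ∈ symmDiff I {k} then u • (κ • v i - 1)
        else v i + algebraMap F A u) (Finset.mem_univ k)]
    rw [Finset.prod_congr rfl (g := fun i => if i ∈ I then u • (κ • v i - 1)
        else v i + algebraMap F A u) (s₁ := Finset.univ.erase k)
        (f := fun i => if i ∈ symmDiff I {k} then u • (κ • v i - 1)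
        else v i + algebraMap F A u) (fun i hi => by simp only [hmem i (Finset.ne_of_mem_erase hi)]),
      ← add_mul]
    convert zero_mul _
    convert zero_mul _
    convert zero_mul _
    simp only [hk, hv]
    split_ifs <;> simp [Algebra.smul_def]
  · intro h
    have hk : k ∈ symmDiff I {k} ↔ k ∉ I := by simp [Finset.mem_symmDiff]
    rw [h] at hk
    tauto
  · simp [symmDiff_symmDiff_cancel_right]

theorem totalDegree_shiftSum_le :
    (shiftSum u κ b c f (X : Fin n → MvPolynomial (Fin n) F)).totalDegree ≤
      n + (Matrix.vandermonde (X : Fin n → MvPolynomial (Fin n) F)).det.totalDegree +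
        f.totalDegree := by
  have hs : ∀ (d : F) (I : Finset (Fin n)) (g : MvPolynomial (Fin n) F),
      (aeval (scaleOn d I (X : Fin n → MvPolynomial (Fin n) F)) g).totalDegree ≤
        g.totalDegree := by
    intro d I g
    refine totalDegree_aeval_le _ (fun i => ?_) g
    exact (totalDegree_smul_le _ _).trans (by simp)
  refine totalDegree_finsetSum_le fun I _ => ?_
  refine (totalDegree_mul _ _).trans (add_le_add ((totalDegree_mul _ _).trans
    (add_le_add ?_ ?_)) (hs c I f))
  · refine (totalDegree_finsetProd _ _).trans ((Finset.sum_le_card_nsmul _ _ 1 fun i _ => ?_).trans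
      (by simp))
    split_ifs
    · refine (totalDegree_smul_le _ _).trans ((totalDegree_sub _ _).trans ?_)
      exact max_le ((totalDegree_smul_le _ _).trans (by simp)) (by simp)
    · exact (totalDegree_add _ _).trans (max_le (by simp) (by simp [algebraMap_eq]))
  · have := hs b I (Matrix.vandermonde (X : Fin n → MvPolynomial (Fin n) F)).det
    simpa only [map_det_vandermonde, aeval_X] using this

/-- The numerator vanishes on the hyperplanes `x_k = 0` and `x_i = x_j`, hence is divisible by the
denominator. Its degree exceeds that of `f` by at most the degree of the denominator, and both
numerator and denominator are antisymmetric. -/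
theorem exists_mul_eq_shiftSum [CharZero F] {f : MvPolynomial (Fin n) F} (hf : f.IsSymmetric) :
    ∃ g : MvPolynomial (Fin n) F, g.IsSymmetric ∧ g.totalDegree ≤ f.totalDegree ∧
      shiftSum u κ b c f X = (∏ i, X i) *
        ((Matrix.vandermonde (X : Fin n → MvPolynomial (Fin n) F)).det * g) := by
  have hX : (∏ i, X i : MvPolynomial (Fin n) F) ≠ 0 :=
    Finset.prod_ne_zero_iff.2 fun i _ => X_ne_zero i
  have hV : (Matrix.vandermonde (X : Fin n → MvPolynomial (Fin n) F)).det ≠ 0 :=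
    Matrix.det_vandermonde_ne_zero_iff.2 (X_injective)
  obtain ⟨g₁, hg₁⟩ : (∏ i, X i) ∣ shiftSum u κ b c f (X : Fin n → MvPolynomial (Fin n) F) := by
    refine prod_linear_dvd _ _ (fun i _ => by simp) (fun i _ j _ hij => ?_) _ fun i _ => ?_
    · exact ⟨Function.update 1 i 0, by simp, by simp [Function.update_of_ne hij.symm]⟩
    · rw [← sub_zero (X i)]
      refine X_sub_dvd_of_aeval_update i 0 _ ?_
      rw [map_shiftSum]
      exact shiftSum_eq_zero_of_zero _ _ _ _ _ (k := i) (by simp)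
  have hdiff : ∀ i j : Fin n, i ≠ j →
      (X j - X i : MvPolynomial (Fin n) F).totalDegree = 1 := fun i j hij => by
    refine totalDegree_X_sub_of_not _ _ (by simp) ?_
    rw [coeff_X, if_neg]
    intro h
    exact hij (Finsupp.single_left_injective one_ne_zero h)
  obtain ⟨g, hg⟩ : (Matrix.vandermonde (X : Fin n → MvPolynomial (Fin n) F)).det ∣ g₁ := by
    rw [Matrix.det_vandermonde, Finset.prod_sigma']
    refine prod_linear_dvd _ _ (fun p hp => ?_) (fun p hp p' hp' hne => ?_) _ fun p hp => ?_
    · exact hdiff _ _ (by simp at hp; exact hp.ne)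
    · obtain ⟨i, j⟩ := p
      obtain ⟨k, l⟩ := p'
      simp only [Finset.mem_sigma, Finset.mem_univ, Finset.mem_Ioi, true_and] at hp hp'
      -- Two distinct pairs of indices: the unit vector at an index of the second pair outside the
      -- first separates the two differences.
      have : ∃ m, m ≠ i ∧ m ≠ j ∧ (m = k ∨ m = l) := by
        by_contra! hcon
        have h1 := hcon k
        have h2 := hcon l
        have : ¬ (i = k ∧ j = l) := by rintro ⟨rfl, rfl⟩; exact hne rfl
        grind
      obtain ⟨m, hmi, hmj, hm⟩ := this
      refine ⟨Pi.single m 1, by simp [hmi.symm, hmj.symm], ?_⟩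
      have := hp'.ne
      rcases hm with rfl | rfl <;> simp [this, this.symm]
    · obtain ⟨i, j⟩ := p
      simp only [Finset.mem_sigma, Finset.mem_univ, Finset.mem_Ioi, true_and] at hp
      refine X_sub_dvd_of_aeval_update j (X i) _ ?_
      have h0 : aeval (Function.update X j (X i : MvPolynomial (Fin n) F))
          (shiftSum u κ b c f (X : Fin n → MvPolynomial (Fin n) F)) = 0 := by
        rw [map_shiftSum]
        refine shiftSum_eq_zero_of_eq _ _ _ _ hf hp.ne ?_
        simp [Function.update_of_ne hp.ne]
      rw [hg₁, map_mul, map_prod] at h0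
      refine (mul_eq_zero.1 h0).resolve_left (Finset.prod_ne_zero_iff.2 fun k _ => ?_)
      rcases eq_or_ne k j with rfl | hk
      · simp
      · simp [Function.update_of_ne hk]
  subst hg
  refine ⟨g, fun e => ?_, ?_, hg₁⟩
  · have h1 := congrArg (rename e) hg₁
    rw [← aeval_X_left_apply (rename e (shiftSum u κ b c f X)), aeval_rename, map_shiftSum] at h1
    simp only [Function.comp_def, aeval_X] at h1
    rw [shiftSum_comp_perm u κ b c hf e, hg₁] at h1
    simp only [map_mul, map_prod, rename_X] at h1
    rw [Equiv.prod_comp e X, show rename e (Matrix.vandermonde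
      (X : Fin n → MvPolynomial (Fin n) F)).det = ((Equiv.Perm.sign e : ℤ) : MvPolynomial _ F) *
        (Matrix.vandermonde (X : Fin n → MvPolynomial (Fin n) F)).det by
      rw [← det_vandermonde_comp_perm, map_det_vandermonde]
      simp only [rename_X]] at h1
    have hs : ((Equiv.Perm.sign e : ℤ) : MvPolynomial (Fin n) F) ≠ 0 := by
      rcases Int.units_eq_one_or (Equiv.Perm.sign e) with h | h <;> simp [h]
    refine (mul_left_cancel₀ (mul_ne_zero hs (mul_ne_zero hX hV)) ?_).symm
    linear_combination h1
  · rcases eq_or_ne g 0 with rfl | hg0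
    · simp
    have hd := totalDegree_shiftSum_le u κ b c f
    have hXd : (∏ i, X i : MvPolynomial (Fin n) F).totalDegree = n := by
      rw [totalDegree_prod_eq_card _ _ fun i _ => by simp, Finset.card_univ, Fintype.card_fin]
    rw [hg₁, totalDegree_mul_of_isDomain hX (mul_ne_zero hV hg0),
      totalDegree_mul_of_isDomain hV hg0, hXd] at hd
    omega

end ShiftOperator

/-! ### Independence of `q` and `t`, and the points `bar μ`. -/

theorem q_ne_zero : q ≠ 0 := by
  rw [q, Ne, FaithfulSMul.algebraMap_eq_zero_iff]
  exact X_ne_zero 0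

theorem t_ne_zero : t ≠ 0 := by
  rw [t, Ne, FaithfulSMul.algebraMap_eq_zero_iff]
  exact X_ne_zero 1

theorem q_pow_mul_t_pow_inj {k l k' l' : ℕ} (h : q ^ k * t ^ l = q ^ k' * t ^ l') :
    k = k' ∧ l = l' := by
  rw [q, t, ← map_pow, ← map_pow, ← map_pow, ← map_pow, ← map_mul, ← map_mul] at h
  have h' := FaithfulSMul.algebraMap_injective _ _ h
  rw [X_pow_eq_monomial, X_pow_eq_monomial, X_pow_eq_monomial, X_pow_eq_monomial, monomial_mul,
    monomial_mul, monomial_left_inj (by simp)] at h'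
  have h0 := DFunLike.congr_fun h' 0
  have h1 := DFunLike.congr_fun h' 1
  simp at h0 h1
  exact ⟨h0, h1⟩

theorem q_zpow_mul_t_zpow_inj {k l k' l' : ℤ} (h : q ^ k * t ^ l = q ^ k' * t ^ l') :
    k = k' ∧ l = l' := by
  -- Multiplying by large powers makes all exponents nonnegative.
  have key : q ^ (k + |k| + |k'|).toNat * t ^ (l + |l| + |l'|).toNat =
      q ^ (k' + |k| + |k'|).toNat * t ^ (l' + |l| + |l'|).toNat := by
    have e1 := neg_abs_le k
    have e2 := neg_abs_le k'
    have e3 := neg_abs_le l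
    have e4 := neg_abs_le l'
    have e5 := abs_nonneg k
    have e6 := abs_nonneg k'
    have e7 := abs_nonneg l
    have e8 := abs_nonneg l'
    rw [← zpow_natCast, ← zpow_natCast, ← zpow_natCast, ← zpow_natCast,
      Int.toNat_of_nonneg (by lia), Int.toNat_of_nonneg (by lia), Int.toNat_of_nonneg (by lia),
      Int.toNat_of_nonneg (by lia)]
    simp only [zpow_add₀ q_ne_zero, zpow_add₀ t_ne_zero]
    linear_combination (q ^ |k| * q ^ |k'| * t ^ |l| * t ^ |l'|) * h
  have := q_pow_mul_t_pow_inj key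
  grind

theorem bar_eq {n : ℕ} (mu : Partitions n) (i : Fin n) :
    bar mu i = q ^ (mu.1 i : ℤ) * t ^ (-(i.val : ℤ)) := by
  rw [bar, tau, zpow_natCast]

theorem bar_ne_zero {n : ℕ} (mu : Partitions n) (i : Fin n) : bar mu i ≠ 0 := by
  rw [bar_eq]
  exact mul_ne_zero (zpow_ne_zero _ q_ne_zero) (zpow_ne_zero _ t_ne_zero)

theorem bar_injective {n : ℕ} (mu : Partitions n) : Function.Injective (bar mu) := by
  intro i j h
  rw [bar_eq, bar_eq] at h
  have := (q_zpow_mul_t_zpow_inj h).2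
  exact Fin.ext (by lia)

/-- The exponent vector of the monomial `x^μ`. -/
noncomputable abbrev Partitions.exponent {n : ℕ} (mu : Partitions n) : Fin n →₀ ℕ :=
  Finsupp.equivFunOnFinite.symm mu.1

/-- Appending a zero part. -/
def Partitions.snocZero {n : ℕ} (mu : Partitions n) : Partitions (n + 1) :=
  ⟨Fin.snoc mu.1 0, by
    intro i j hij
    induction j using Fin.lastCases with
    | last => simp
    | cast j =>
      induction i using Fin.lastCases with
      | last => exact absurd hij (not_le.2 (Fin.castSucc_lt_last j))
      | cast i => simpa using mu.2 (by simpa using hij)⟩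

/-- Adding one to all parts. -/
def Partitions.succ {n : ℕ} (mu : Partitions n) : Partitions n :=
  ⟨fun i => mu.1 i + 1, fun _ _ h => Nat.add_le_add_right (mu.2 h) 1⟩

theorem Partitions.size_snocZero {n : ℕ} (mu : Partitions n) : mu.snocZero.size = mu.size := by
  simp [Partitions.size, Partitions.snocZero, Fin.sum_univ_castSucc]

theorem Partitions.size_succ {n : ℕ} (mu : Partitions n) : mu.succ.size = mu.size + n := by
  simp [Partitions.size, Partitions.succ, Finset.sum_add_distrib]

/-! ### Specializing the last variable. -/

section Restriction

variable {F : Type*} [Field F] {n : ℕ}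

/-- Specialization of the last variable. -/
noncomputable def evalLast (c : F) : MvPolynomial (Fin (n + 1)) F →ₐ[F] MvPolynomial (Fin n) F :=
  aeval (Fin.snoc (α := fun _ => MvPolynomial (Fin n) F) X (C c))

theorem totalDegree_evalLast_le (c : F) (f : MvPolynomial (Fin (n + 1)) F) :
    (evalLast c f).totalDegree ≤ f.totalDegree := by
  refine totalDegree_aeval_le _ (fun i => ?_) f
  induction i using Fin.lastCases <;> simp

theorem isSymmetric_evalLast (c : F) {f : MvPolynomial (Fin (n + 1)) F} (hf : f.IsSymmetric) :
    (evalLast c f).IsSymmetric := by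
  intro e
  let e' : Equiv.Perm (Fin (n + 1)) := finSuccEquivLast.symm.permCongr (Equiv.optionCongr e)
  have h : (rename e).comp (evalLast c : MvPolynomial (Fin (n + 1)) F →ₐ[F] _) =
      (evalLast c).comp (rename e') := by
    refine algHom_ext fun i => ?_
    induction i using Fin.lastCases <;> simp [evalLast, e', Equiv.permCongr_apply]
  have := DFunLike.congr_fun h f
  simpa only [AlgHom.comp_apply, hf e'] using this

theorem eval_evalLast (c : F) (f : MvPolynomial (Fin (n + 1)) F) (v : Fin n → F) :
    eval v (evalLast c f) = eval (Fin.snoc (α := fun _ => F) v c) f := by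
  rw [← coe_aeval_eq_eval, ← coe_aeval_eq_eval, RingHom.coe_coe, RingHom.coe_coe, evalLast,
    ← AlgHom.comp_apply, comp_aeval]
  congr 2
  funext i
  induction i using Fin.lastCases <;> simp

/-- By the degree bound, a monomial restricting to `x^μ` cannot contain the last variable, so no
lower term interferes. -/
theorem coeff_evalLast (c : F) (f : MvPolynomial (Fin (n + 1)) F) (mu : Partitions n)
    (hd : f.totalDegree ≤ mu.size) :
    coeff mu.exponent (evalLast c f) = coeff mu.snocZero.exponent f := by
  have hmon : ∀ (s : Fin (n + 1) →₀ ℕ) (r : F), evalLast c (monomial s r) =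
      monomial (Finsupp.equivFunOnFinite.symm fun i : Fin n => s i.castSucc)
        (r * c ^ s (Fin.last n)) := by
    intro s r
    rw [evalLast, aeval_monomial, algebraMap_eq, Finsupp.prod_fintype _ _ (by simp),
      Fin.prod_univ_castSucc, monomial_eq, Finsupp.prod_fintype _ _ (by simp)]
    simp
    ring
  conv_lhs => rw [f.as_sum, map_sum, coeff_sum]
  rw [Finset.sum_eq_single mu.snocZero.exponent]
  · rw [hmon]
    simp [coeff_monomial, Partitions.snocZero, Partitions.exponent]
  · intro s hs hne
    rw [hmon, coeff_monomial, if_neg]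
    intro h
    have hs' : ∀ i : Fin n, s i.castSucc = mu.1 i := fun i => by
      simpa using DFunLike.congr_fun h i
    have h1 := (le_totalDegree hs).trans hd
    rw [Finsupp.sum_fintype _ _ (by simp), Fin.sum_univ_castSucc] at h1
    simp only [hs', Partitions.size] at h1
    refine hne (Finsupp.ext fun i => ?_)
    induction i using Fin.lastCases with
    | last => simp [Partitions.snocZero, Partitions.exponent]; lia
    | cast i => simp [Partitions.snocZero, Partitions.exponent, hs']
  · intro hs
    rw [notMem_support_iff.1 hs]
    simp

theorem totalDegree_X_sub_C (i : Fin n) (c : F) :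
    (X i - C c : MvPolynomial (Fin n) F).totalDegree = 1 := by
  refine totalDegree_X_sub_of_not i _ (by simp) ?_
  rw [coeff_C, if_neg (Finsupp.single_ne_zero.2 one_ne_zero).symm]

theorem dvd_of_evalLast_eq_zero (c : F) {f : MvPolynomial (Fin (n + 1)) F} (hf : f.IsSymmetric)
    (h : evalLast c f = 0) : ∏ i, (X i - C c) ∣ f := by
  have hlast : X (Fin.last n) - C c ∣ f := by
    refine X_sub_dvd_of_aeval_update _ _ _ ?_
    have : aeval (Function.update X (Fin.last n) (C c)) =
        (rename Fin.castSucc).comp (evalLast c : MvPolynomial (Fin (n + 1)) F →ₐ[F] _) := by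
      refine algHom_ext fun i => ?_
      induction i using Fin.lastCases <;> simp [evalLast]
    rw [this, AlgHom.comp_apply, h, map_zero]
  refine prod_linear_dvd _ _ (fun i _ => ?_) (fun i _ j _ hij => ?_) _ fun i _ => ?_
  · exact totalDegree_X_sub_C i c
  · exact ⟨Function.update (fun _ => c + 1) i c, by simp, by simp [Function.update_of_ne hij.symm]⟩
  · have := map_dvd (rename (Equiv.swap i (Fin.last n))) hlast
    rw [hf] at this
    simpa using this

/-- Each constant `-c` loses one degree, so only the product of the variables reaches this
top-degree coefficient. -/
theorem coeff_prod_X_sub_mul (c : F) (g : MvPolynomial (Fin n) F) (m : Fin n →₀ ℕ)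
    (hg : g.totalDegree ≤ ∑ i, m i) (s : Finset (Fin n)) :
    coeff (m + ∑ i ∈ s, Finsupp.single i 1) ((∏ i ∈ s, (X i - C c)) * g) = coeff m g := by
  induction s using Finset.induction_on with
  | empty => simp
  | insert i s hi ih =>
    rw [Finset.prod_insert hi, Finset.sum_insert hi, mul_assoc, sub_mul, coeff_sub,
      add_left_comm, coeff_X_mul, ih, coeff_C_mul, sub_eq_self]
    refine mul_eq_zero_of_right _ (coeff_eq_zero_of_totalDegree_lt ?_)
    have h1 : ((∏ i ∈ s, (X i - C c)) * g).totalDegree ≤ s.card + ∑ i, m i := by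
      refine (totalDegree_mul _ _).trans (add_le_add ?_ hg)
      refine (totalDegree_finsetProd _ _).trans
        ((Finset.sum_le_card_nsmul _ _ 1 fun i _ => ?_).trans (by simp))
      exact (totalDegree_sub _ _).trans (by simp)
    refine lt_of_le_of_lt h1 ?_
    change _ < (Finsupp.single i 1 + (m + ∑ x ∈ s, Finsupp.single x 1)).sum fun _ e => e
    rw [Finsupp.sum_fintype _ _ (by simp)]
    have h2 : ∑ j, ∑ x ∈ s, (Finsupp.single x 1 : Fin n →₀ ℕ) j = s.card := by
      rw [Finset.sum_comm]
      simp [Finsupp.single_apply]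
    simp only [Finsupp.add_apply, Finset.sum_add_distrib, Finsupp.finsetSum_apply, h2]
    simp [Finsupp.single_apply]
    lia

end Restriction

/-- A symmetric polynomial of degree at most `d` is determined by one datum for every partition of
size at most `d`: its value at `s • bar μ` or, if `|μ| = d`, alternatively its coefficient of
`x^μ`. -/
theorem eq_zero_of_vanishing {n : ℕ} (d : ℕ) (s : BaseField) (hs : s ≠ 0)
    (f : MvPolynomial (Fin n) BaseField) (hf : f.IsSymmetric) (hd : f.totalDegree ≤ d)
    (h : ∀ mu : Partitions n, mu.size ≤ d → eval (fun i => s * bar mu i) f = 0 ∨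
      (mu.size = d ∧ coeff mu.exponent f = 0)) : f = 0 := by
  induction n generalizing d s with
  | zero =>
    obtain ⟨r, rfl⟩ := C_surjective (Fin 0) f
    have := h ⟨fun _ => 0, fun _ _ _ => le_rfl⟩ (by simp [Partitions.size])
    have hr : r = 0 := by
      rcases this with h | h
      · simpa using h
      · simpa [Subsingleton.elim _ (0 : Fin 0 →₀ ℕ)] using h.2
    rw [hr, map_zero]
  | succ n ihn =>
    induction d using Nat.strong_induction_on generalizing s f with
    | h d ihd =>
      by_contra hne
      -- The last coordinate of `s • bar μ` when the last part of `μ` is zero. Such `μ` force `f` to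
      -- vanish at `x_last = c`.
      set c := s * t ^ (-(n : ℤ)) with hc
      have h0 : evalLast c f = 0 := by
        refine ihn d s hs _ (isSymmetric_evalLast c hf) ((totalDegree_evalLast_le c f).trans hd)
          fun mu hmu => ?_
        refine (h mu.snocZero (by rwa [mu.size_snocZero])).imp (fun h1 => ?_) fun h1 => ?_
        · rw [eval_evalLast, ← h1]
          congr 2
          funext i
          induction i using Fin.lastCases <;> simp [bar, tau, Partitions.snocZero, hc]
        · rw [mu.size_snocZero] at h1
          exact ⟨h1.1, by rw [coeff_evalLast c f mu (by lia), h1.2]⟩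
      obtain ⟨g, rfl⟩ := dvd_of_evalLast_eq_zero c hf h0
      have hg0 : g ≠ 0 := right_ne_zero_of_mul hne
      have hP0 := left_ne_zero_of_mul hne
      have hPs : (∏ i, (X i - C c) : MvPolynomial (Fin (n + 1)) BaseField).IsSymmetric := by
        intro e
        simp only [map_prod, map_sub, rename_X, rename_C]
        exact Equiv.prod_comp e fun i => (X i - C c : MvPolynomial (Fin (n + 1)) BaseField)
      have hgs : g.IsSymmetric := by
        intro e
        have := hf e
        rw [map_mul, hPs e] at this
        exact mul_left_cancel₀ hP0 this
      have hPd : (∏ i, (X i - C c) : MvPolynomial (Fin (n + 1)) BaseField).totalDegree = n + 1 := by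
        rw [totalDegree_prod_eq_card _ _ fun i _ => totalDegree_X_sub_C i c, Finset.card_univ,
          Fintype.card_fin]
      rw [totalDegree_mul_of_isDomain hP0 hg0, hPd] at hd
      -- Partitions with all parts positive are `μ + (1^n)` in the number of variables at hand.
      -- Since `bar` of this is `q • bar μ`, the quotient satisfies the same conditions with scale
      -- `s * q`.
      refine hg0 (ihd (d - (n + 1)) (by lia) (s * q) (mul_ne_zero hs q_ne_zero) g hgs (by lia)
        fun mu hmu => ?_)
      refine (h mu.succ (by rw [mu.size_succ]; lia)).imp (fun h1 => ?_) fun h1 => ?_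
      · rw [map_mul, map_prod] at h1
        convert (mul_eq_zero.1 h1).resolve_left (Finset.prod_ne_zero_iff.2 fun i _ => ?_) using 3
          with i
        · funext i
          simp only [bar, Partitions.succ, pow_succ]
          ring
        · rw [map_sub, eval_X, eval_C, hc, ← mul_sub, bar_eq]
          refine mul_ne_zero hs (sub_ne_zero.2 fun h2 => ?_)
          rw [← one_mul (t ^ (-(n : ℤ))), ← zpow_zero q] at h2
          have := (q_zpow_mul_t_zpow_inj h2).1
          simp only [Partitions.succ] at this
          lia
      · rw [mu.size_succ] at h1
        have hm : mu.succ.exponent = mu.exponent + ∑ i, Finsupp.single i 1 := by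
          ext i
          simp [Partitions.succ, Partitions.exponent, Finsupp.single_apply]
        refine ⟨by lia, ?_⟩
        rw [← h1.2, hm, coeff_prod_X_sub_mul]
        change g.totalDegree ≤ mu.size
        lia

/-! ### Existence and uniqueness of `R_λ`. -/

theorem Partitions.finite_size_le (n d : ℕ) : Finite {mu : Partitions n // mu.size ≤ d} := by
  refine Finite.of_injective
    (fun mu (i : Fin n) => (⟨mu.1.1 i, Nat.lt_succ_of_le ((Finset.single_le_sum
      (f := mu.1.1) (fun _ _ => Nat.zero_le _) (Finset.mem_univ i)).trans mu.2)⟩ : Fin (d + 1)))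
    fun mu nu h => Subtype.ext (Subtype.ext (funext fun i => ?_))
  simpa using congrFun h i

theorem antitone_eq_of_comp_perm {n : ℕ} {a b : Fin n → ℕ} (ha : Antitone a) (hb : Antitone b)
    (e : Equiv.Perm (Fin n)) (h : ∀ i, a (e i) = b i) : a = b := by
  have h1 : a ∘ e = a := Tuple.unique_antitone (σ := e) (τ := 1) ?_ ?_
  · funext i; rw [← h i]; exact (congrFun h1 i).symm
  · have : a ∘ e = b := funext h
    rwa [this]
  · exact ha

/-- The symmetrization of the monomial `x^μ` over all permutations of the variables. -/
noncomputable def monomialSymm {n : ℕ} (mu : Partitions n) : MvPolynomial (Fin n) BaseField :=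
  ∑ e : Equiv.Perm (Fin n), rename e (monomial mu.exponent 1)

theorem isSymmetric_monomialSymm {n : ℕ} (mu : Partitions n) : (monomialSymm mu).IsSymmetric := by
  intro e
  rw [monomialSymm, map_sum]
  refine Fintype.sum_equiv (Equiv.mulLeft e) _ _ fun e' => ?_
  rw [rename_rename]
  rfl

theorem totalDegree_monomialSymm_le {n : ℕ} (mu : Partitions n) :
    (monomialSymm mu).totalDegree ≤ mu.size := by
  refine totalDegree_finsetSum_le fun e _ => (totalDegree_rename_le _ _).trans
    ((totalDegree_monomial_le _ _).trans ?_)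
  change (mu.exponent.sum fun _ e => e) ≤ _
  rw [Finsupp.sum_fintype _ _ (by simp)]
  rfl

theorem coeff_monomialSymm_of_ne {n : ℕ} {mu nu : Partitions n} (h : mu ≠ nu) :
    coeff nu.exponent (monomialSymm mu) = 0 := by
  rw [monomialSymm, coeff_sum]
  refine Finset.sum_eq_zero fun e _ => ?_
  rw [rename_monomial, coeff_monomial, if_neg]
  intro h'
  refine h (Subtype.ext (antitone_eq_of_comp_perm nu.2 mu.2 e fun i => ?_)).symm
  have := DFunLike.congr_fun h' (e i)
  rw [Finsupp.mapDomain_apply e.injective] at this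
  exact this.symm

theorem coeff_monomialSymm_self {n : ℕ} (mu : Partitions n) :
    coeff mu.exponent (monomialSymm mu) ≠ 0 := by
  have : coeff mu.exponent (monomialSymm mu) = ((Finset.univ.filter fun e : Equiv.Perm (Fin n) =>
      Finsupp.mapDomain e mu.exponent = mu.exponent).card : BaseField) := by
    rw [monomialSymm, coeff_sum, Finset.card_filter, Nat.cast_sum]
    refine Finset.sum_congr rfl fun e _ => ?_
    rw [rename_monomial, coeff_monomial]
    simp
  rw [this, Nat.cast_ne_zero, ← Nat.pos_iff_ne_zero, Finset.card_pos]
  exact ⟨1, by simp [Finsupp.mapDomain_id]⟩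

/-- The conditions form a square linear system on the span of the symmetrized monomials of degree at
most `|λ|`: one unknown and one equation per partition. It is injective by `eq_zero_of_vanishing`,
hence surjective. -/
theorem exists_isSymInterpolation {n : ℕ} (lam : Partitions n) :
    ∃ R, IsSymInterpolation lam R := by
  classical
  have := Partitions.finite_size_le n lam.size
  have := Fintype.ofFinite {mu : Partitions n // mu.size ≤ lam.size}
  let S : ({mu : Partitions n // mu.size ≤ lam.size} → BaseField) →ₗ[BaseField]
      MvPolynomial (Fin n) BaseField := Fintype.linearCombination BaseField
        fun mu => monomialSymm mu.1
  have hS : ∀ c, S c = ∑ mu, c mu • monomialSymm mu.1 := fun c => rfl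
  have hsym : ∀ c, (S c).IsSymmetric := fun c => by
    rw [hS, ← mem_symmetricSubalgebra]
    exact sum_mem fun mu _ => Subalgebra.smul_mem _ (isSymmetric_monomialSymm mu.1) _
  have hdeg : ∀ c, (S c).totalDegree ≤ lam.size := fun c => by
    rw [hS]
    exact totalDegree_finsetSum_le fun mu _ => (totalDegree_smul_le _ _).trans
      ((totalDegree_monomialSymm_le _).trans mu.2)
  have hcoeff : ∀ c mu, coeff mu.1.exponent (S c) =
      c mu * coeff mu.1.exponent (monomialSymm mu.1) := fun c mu => by
    rw [hS, coeff_sum, Finset.sum_eq_single mu]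
    · simp
    · intro nu _ hne
      rw [coeff_smul, coeff_monomialSymm_of_ne fun h => hne (Subtype.ext h), smul_zero]
    · simp
  let T : ({mu : Partitions n // mu.size ≤ lam.size} → BaseField) →ₗ[BaseField]
      ({mu : Partitions n // mu.size ≤ lam.size} → BaseField) := LinearMap.pi fun mu =>
        if mu.1 = lam then lcoeff BaseField lam.exponent ∘ₗ S
        else (aeval (bar mu.1)).toLinearMap ∘ₗ S
  have hT : Function.Injective T := by
    rw [← LinearMap.ker_eq_bot, LinearMap.ker_eq_bot']
    intro c hc
    have hzero : S c = 0 := by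
      refine eq_zero_of_vanishing lam.size 1 one_ne_zero _ (hsym c) (hdeg c) fun mu hmu => ?_
      have := congrFun hc ⟨mu, hmu⟩
      by_cases h : mu = lam
      · subst h
        right
        exact ⟨rfl, by simpa [T] using this⟩
      · left
        simpa [T, h, aeval_eq_eval] using this
    funext mu
    have := hcoeff c mu
    rw [hzero, coeff_zero] at this
    exact (mul_eq_zero.1 this.symm).resolve_right (coeff_monomialSymm_self mu.1)
  obtain ⟨c, hc⟩ := LinearMap.injective_iff_surjective.1 hT (Pi.single ⟨lam, le_rfl⟩ 1)
  refine ⟨S c, hsym c, hdeg c, fun mu hmu hne => ?_, ?_⟩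
  · have := congrFun hc ⟨mu, hmu⟩
    simpa [T, hne, aeval_eq_eval] using this
  · have := congrFun hc ⟨lam, le_rfl⟩
    simpa [T] using this

theorem isSymInterpolation_symInterpolation {n : ℕ} (lam : Partitions n) :
    IsSymInterpolation lam (symInterpolation lam) := by
  rw [symInterpolation, dif_pos (exists_isSymInterpolation lam)]
  exact (exists_isSymInterpolation lam).choose_spec

theorem existsUnique_isSymInterpolation {n : ℕ} (lam : Partitions n) :
    ∃! R, IsSymInterpolation lam R := by
  refine existsUnique_of_exists_of_unique (exists_isSymInterpolation lam) fun R R' h h' => ?_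
  refine sub_eq_zero.1 (eq_zero_of_vanishing lam.size 1 one_ne_zero _
    (h.symmetric.sub h'.symmetric)
    ((totalDegree_sub _ _).trans (max_le h.degree_le h'.degree_le)) fun mu hmu => ?_)
  by_cases hne : mu = lam
  · subst hne
    exact Or.inr ⟨rfl, by rw [coeff_sub, h.coeff_eq_one, h'.coeff_eq_one, sub_self]⟩
  · left
    simp only [one_mul]
    change eval (bar mu) _ = 0
    rw [map_sub, h.vanishing mu hmu hne, h'.vanishing mu hmu hne, sub_self]

theorem symInterpolation_ne_zero {n : ℕ} (lam : Partitions n) : symInterpolation lam ≠ 0 := by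
  intro h
  have := (isSymInterpolation_symInterpolation lam).coeff_eq_one
  simp [h] at this

/-- A symmetric polynomial of degree at most `|λ|` vanishing where `R_λ` is required to vanish is
determined by its value at `bar λ`. -/
theorem eq_zero_of_vanishing_bar {n : ℕ} (lam : Partitions n)
    {f : MvPolynomial (Fin n) BaseField} (hf : f.IsSymmetric) (hd : f.totalDegree ≤ lam.size)
    (h : ∀ mu : Partitions n, mu.size ≤ lam.size → eval (bar mu) f = 0) : f = 0 := by
  refine eq_zero_of_vanishing lam.size 1 one_ne_zero f hf hd fun mu hmu => Or.inl ?_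
  simpa only [one_mul] using h mu hmu

theorem eval_symInterpolation_self_ne_zero {n : ℕ} (lam : Partitions n) :
    eval (bar lam) (symInterpolation lam) ≠ 0 := by
  intro h
  have hR := isSymInterpolation_symInterpolation lam
  refine symInterpolation_ne_zero lam
    (eq_zero_of_vanishing_bar lam hR.symmetric hR.degree_le fun mu hmu => ?_)
  by_cases hne : mu = lam
  · rwa [hne]
  · exact hR.vanishing mu hmu hne

/-- `R_λ` spans the symmetric polynomials of degree at most `|λ|` with its vanishing
properties. -/
theorem eq_smul_symInterpolation {n : ℕ} (lam : Partitions n)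
    {f : MvPolynomial (Fin n) BaseField} (hf : f.IsSymmetric) (hd : f.totalDegree ≤ lam.size)
    (h : ∀ mu : Partitions n, mu.size ≤ lam.size → mu ≠ lam → eval (bar mu) f = 0) :
    f = (eval (bar lam) f / eval (bar lam) (symInterpolation lam)) • symInterpolation lam := by
  have hR := isSymInterpolation_symInterpolation lam
  refine sub_eq_zero.1 (eq_zero_of_vanishing_bar lam (hf.sub (hR.symmetric.smul _))
    ((totalDegree_sub _ _).trans (max_le hd ((totalDegree_smul_le _ _).trans hR.degree_le)))
    fun mu hmu => ?_)
  rw [map_sub, smul_eval]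
  by_cases hne : mu = lam
  · rw [hne, div_mul_cancel₀ _ (eval_symInterpolation_self_ne_zero lam), sub_self]
  · rw [h mu hmu hne, hR.vanishing mu hmu hne, mul_zero, sub_self]

/-! ### The eigenvalue equation. -/

theorem coeff_prod_one_add_X_mul {F : Type*} [Field F] {n : ℕ} (w : Fin n → F) (r : ℕ) :
    (∏ i, (1 + Polynomial.X * Polynomial.C (w i))).coeff r = eval w (esymm (Fin n) F r) := by
  rw [Finset.prod_one_add, Polynomial.finsetSum_coeff, esymm, map_sum,
    Finset.powersetCard_eq_filter, Finset.sum_filter]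
  refine Finset.sum_congr rfl fun s _ => ?_
  rw [Finset.prod_mul_distrib, Finset.prod_const, ← map_prod, Polynomial.coeff_X_pow_mul',
    Polynomial.coeff_C, map_prod]
  simp only [eval_X]
  split_ifs <;> first | rfl | lia

theorem totalDegree_esymm_le {F : Type*} [Field F] (n r : ℕ) :
    (esymm (Fin n) F r).totalDegree ≤ r := by
  refine totalDegree_finsetSum_le fun s hs => (totalDegree_finsetProd _ _).trans ?_
  simp [(Finset.mem_powersetCard.1 hs).2]

/-- The coefficient, as a polynomial in the parameter of the operator, with which the point
`bar σ` shifted in the coordinates in `I` contributes at `bar σ`. -/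
noncomputable def shiftPoly {n : ℕ} (sigma : Partitions n) (I : Finset (Fin n)) :
    Polynomial BaseField :=
  (∏ i, if i ∈ I then Polynomial.X * Polynomial.C (t ^ (n - 1) * bar sigma i - 1)
    else Polynomial.X + Polynomial.C (bar sigma i)) *
    Polynomial.C (Matrix.vandermonde (scaleOn t⁻¹ I (bar sigma))).det

theorem shiftTerm_bar {n : ℕ} (sigma : Partitions n) (I : Finset (Fin n)) (u : BaseField)
    (f : MvPolynomial (Fin n) BaseField) :
    shiftTerm u (t ^ (n - 1)) t⁻¹ q⁻¹ f (bar sigma) I =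
      (shiftPoly sigma I).eval u * eval (scaleOn q⁻¹ I (bar sigma)) f := by
  rw [shiftTerm, shiftPoly, Polynomial.eval_mul, Polynomial.eval_C, Polynomial.eval_prod,
    aeval_eq_eval]
  congr 2
  refine Finset.prod_congr rfl fun i _ => ?_
  split_ifs <;> simp [add_comm]

/-- Isolates one factor `u` per shifted variable, so that degree `r` in `u` only sees sets `I` with
at most `r` elements. -/
theorem shiftPoly_eq {n : ℕ} (sigma : Partitions n) (I : Finset (Fin n)) :
    shiftPoly sigma I = Polynomial.X ^ I.card *
      (Polynomial.C (∏ i ∈ I, (t ^ (n - 1) * bar sigma i - 1)) *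
        (∏ i ∈ Iᶜ, (Polynomial.X + Polynomial.C (bar sigma i))) *
        Polynomial.C (Matrix.vandermonde (scaleOn t⁻¹ I (bar sigma))).det) := by
  rw [shiftPoly, Finset.prod_ite, Finset.prod_mul_distrib, Finset.prod_const, map_prod,
    Finset.filter_mem_eq_inter, Finset.univ_inter,
    show (Finset.univ.filter fun i => i ∉ I) = Iᶜ by ext; simp]
  ring

theorem coeff_shiftPoly_of_lt {n : ℕ} (sigma : Partitions n) {I : Finset (Fin n)} {r : ℕ}
    (h : r < I.card) : (shiftPoly sigma I).coeff r = 0 := by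
  rw [shiftPoly_eq, Polynomial.coeff_X_pow_mul', if_neg (not_le.2 h)]

theorem coeff_shiftPoly_card {n : ℕ} (sigma : Partitions n) (I : Finset (Fin n)) :
    (shiftPoly sigma I).coeff I.card = (∏ i ∈ I, (t ^ (n - 1) * bar sigma i - 1)) *
      (∏ i ∈ Iᶜ, bar sigma i) * (Matrix.vandermonde (scaleOn t⁻¹ I (bar sigma))).det := by
  rw [shiftPoly_eq, Polynomial.coeff_X_pow_mul', if_pos le_rfl, Nat.sub_self,
    Polynomial.coeff_zero_eq_eval_zero]
  simp [Polynomial.eval_prod]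

/-- `σ` is obtained from `ν` by adding one to the parts with index in `I`. -/
def Partitions.AddOn {n : ℕ} (nu : Partitions n) (I : Finset (Fin n)) (sigma : Partitions n) :
    Prop :=
  ∀ i, sigma.1 i = nu.1 i + if i ∈ I then 1 else 0

theorem Partitions.AddOn.size {n : ℕ} {nu sigma : Partitions n} {I : Finset (Fin n)}
    (h : nu.AddOn I sigma) : sigma.size = nu.size + I.card := by
  simp only [Partitions.size, h _, Finset.sum_add_distrib]
  simp

theorem Partitions.AddOn.scaleOn_bar {n : ℕ} {nu sigma : Partitions n} {I : Finset (Fin n)}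
    (h : nu.AddOn I sigma) : scaleOn q⁻¹ I (bar sigma) = bar nu := by
  funext i
  have := q_ne_zero
  rw [scaleOn, bar, bar, h i]
  split_ifs
  · rw [smul_eq_mul, pow_succ]
    field_simp
  · simp

/-- There are two ways for `σ - 1_I` not to be a partition. If a zero last part is lowered, the
factor `t^(n-1) bar σ_n - 1` vanishes; this is why `κ = t^(n-1)`. If the first of two equal adjacent
parts is lowered alone, dividing its coordinate by `t` makes two Vandermonde nodes coincide. -/
theorem exists_addOn_or_shiftPoly_eq_zero {n : ℕ} (sigma : Partitions n) (I : Finset (Fin n)) :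
    (∃ nu : Partitions n, nu.AddOn I sigma) ∨ shiftPoly sigma I = 0 := by
  rcases n with _ | n
  · exact Or.inl ⟨sigma, fun i => i.elim0⟩
  by_cases hanti : ∀ i : Fin n, sigma.1 i.succ + (if i.castSucc ∈ I then 1 else 0) ≤
      sigma.1 i.castSucc + if i.succ ∈ I then 1 else 0
  · by_cases hlast : sigma.1 (Fin.last n) = 0 ∧ Fin.last n ∈ I
    · right
      rw [shiftPoly, Finset.prod_eq_zero (Finset.mem_univ (Fin.last n)), zero_mul]
      have := t_ne_zero
      simp [hlast, bar, tau, this]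
    · left
      have hanti' : Antitone fun i => (sigma.1 i : ℤ) - if i ∈ I then 1 else 0 := by
        rw [Fin.antitone_iff_succ_le]
        intro i
        have := hanti i
        split_ifs at this ⊢ <;> lia
      have hpos : ∀ i, (if i ∈ I then 1 else 0) ≤ sigma.1 i := by
        intro i
        have h1 := hanti' (Fin.le_last i)
        simp only at h1
        split_ifs at h1 ⊢ <;> grind
      refine ⟨⟨fun i => sigma.1 i - if i ∈ I then 1 else 0, fun i j hij => ?_⟩, fun i => ?_⟩
      · have h1 := hanti' hij
        simp only at h1 ⊢
        split_ifs at h1 ⊢ <;> lia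
      · exact (Nat.sub_add_cancel (hpos i)).symm
  · right
    push Not at hanti
    obtain ⟨i, hi⟩ := hanti
    have hle := sigma.2 (Fin.castSucc_lt_succ (i := i)).le
    have h1 : i.castSucc ∈ I := by by_contra h; simp [h] at hi; split_ifs at hi <;> lia
    have h2 : i.succ ∉ I := by intro h; simp [h1, h] at hi; lia
    have h3 : sigma.1 i.succ = sigma.1 i.castSucc := by simp [h1, h2] at hi; lia
    rw [shiftPoly, Matrix.det_vandermonde_eq_zero_iff.2 ⟨i.castSucc, i.succ, ?_,
      (Fin.castSucc_lt_succ (i := i)).ne⟩, map_zero, mul_zero]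
    rw [scaleOn, scaleOn, if_pos h1, if_neg h2, one_smul, smul_eq_mul, bar_eq, bar_eq, h3,
      Fin.val_succ, Fin.val_castSucc]
    push_cast
    rw [neg_add, zpow_add₀ t_ne_zero, zpow_neg_one]
    ring

/-- The image of `R_λ` under the operator again vanishes at the required points, so it is a multiple
of `R_λ`. At `bar λ` only `I = ∅` survives, which gives the eigenvalue. -/
theorem shiftSum_bar {n : ℕ} (lam sigma : Partitions n) (u : BaseField) :
    shiftSum u (t ^ (n - 1)) t⁻¹ q⁻¹ (symInterpolation lam) (bar sigma) =
      (∏ i, bar sigma i) * ((Matrix.vandermonde (bar sigma)).det *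
        ((∏ i, (1 + u * (bar lam i)⁻¹)) * eval (bar sigma) (symInterpolation lam))) := by
  have hR := isSymInterpolation_symInterpolation lam
  obtain ⟨g, hgs, hgd, hg⟩ := exists_mul_eq_shiftSum u (t ^ (n - 1)) t⁻¹ q⁻¹ hR.symmetric
  have heval : ∀ mu : Partitions n,
      shiftSum u (t ^ (n - 1)) t⁻¹ q⁻¹ (symInterpolation lam) (bar mu) =
        (∏ i, bar mu i) * ((Matrix.vandermonde (bar mu)).det * eval (bar mu) g) := by
    intro mu
    have := congrArg (aeval (bar mu)) hg
    rw [map_shiftSum, map_mul, map_mul, map_det_vandermonde, map_prod] at this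
    simpa only [aeval_X, aeval_eq_eval] using this
  have hne : ∀ mu : Partitions n, (∏ i, bar mu i) * (Matrix.vandermonde (bar mu)).det ≠ 0 :=
    fun mu => mul_ne_zero (Finset.prod_ne_zero_iff.2 fun i _ => bar_ne_zero mu i)
      (Matrix.det_vandermonde_ne_zero_iff.2 (bar_injective mu))
  have hterm : ∀ (mu : Partitions n) (I : Finset (Fin n)), mu.size ≤ lam.size →
      (mu = lam → I.Nonempty) →
      shiftTerm u (t ^ (n - 1)) t⁻¹ q⁻¹ (symInterpolation lam) (bar mu) I = 0 := by
    intro mu I hmu hI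
    rw [shiftTerm_bar]
    rcases exists_addOn_or_shiftPoly_eq_zero mu I with ⟨nu, hnu⟩ | h
    · rw [hnu.scaleOn_bar, hR.vanishing nu, mul_zero]
      · have := hnu.size
        lia
      · rintro rfl
        have := hnu.size
        have hcard : I.card = 0 := by lia
        rw [Finset.card_eq_zero] at hcard
        subst hcard
        have : mu = nu := Subtype.ext (funext fun i => by simpa using hnu i)
        simpa using hI this
    · rw [h, Polynomial.eval_zero, zero_mul]
  have hgR : g = (eval (bar lam) g / eval (bar lam) (symInterpolation lam)) •
      symInterpolation lam := by
    refine eq_smul_symInterpolation lam hgs (hgd.trans hR.degree_le) fun mu hmu hml => ?_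
    have := heval mu
    rw [shiftSum, Finset.sum_eq_zero fun I _ => hterm mu I hmu fun h => absurd h hml,
      ← mul_assoc] at this
    exact (mul_eq_zero.1 this.symm).resolve_left (hne mu)
  have hlam : eval (bar lam) g =
      (∏ i, (1 + u * (bar lam i)⁻¹)) * eval (bar lam) (symInterpolation lam) := by
    have := heval lam
    rw [shiftSum, Finset.sum_eq_single ∅ (fun I _ hI => hterm lam I le_rfl fun _ =>
      Finset.nonempty_iff_ne_empty.2 hI) (by simp), shiftTerm_bar] at this
    have h1 : ∀ d : BaseField, scaleOn d ∅ (bar lam) = bar lam := by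
      intro d; funext i; simp [scaleOn]
    have h2 : (shiftPoly lam ∅).eval u = (∏ i, bar lam i) *
        (Matrix.vandermonde (bar lam)).det * ∏ i, (1 + u * (bar lam i)⁻¹) := by
      rw [shiftPoly, h1, Polynomial.eval_mul, Polynomial.eval_C, Polynomial.eval_prod,
        mul_right_comm, ← Finset.prod_mul_distrib]
      congr 1
      refine Finset.prod_congr rfl fun i _ => ?_
      have := bar_ne_zero lam i
      simp
      field_simp
      ring
    rw [h1, h2] at this
    refine mul_left_cancel₀ (hne lam) ?_
    linear_combination -this
  rw [heval sigma, hgR, smul_eval, hlam,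
    mul_div_cancel_right₀ _ (eval_symInterpolation_self_ne_zero lam)]

/-- The eigenvalue equation of `R_λ` at `bar σ`, compared in degree `r` of the parameter. -/
theorem esymm_mul_eval_symInterpolation {n : ℕ} (lam sigma : Partitions n) (r : ℕ) :
    (∏ i, bar sigma i) * (Matrix.vandermonde (bar sigma)).det *
        (eval (fun i => (bar lam i)⁻¹) (esymm (Fin n) BaseField r) *
          eval (bar sigma) (symInterpolation lam)) =
      ∑ I : Finset (Fin n), (shiftPoly sigma I).coeff r *
        eval (scaleOn q⁻¹ I (bar sigma)) (symInterpolation lam) := by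
  have h : Polynomial.C ((∏ i, bar sigma i) * (Matrix.vandermonde (bar sigma)).det *
      eval (bar sigma) (symInterpolation lam)) *
        (∏ i, (1 + Polynomial.X * Polynomial.C (bar lam i)⁻¹)) =
      ∑ I : Finset (Fin n), shiftPoly sigma I *
        Polynomial.C (eval (scaleOn q⁻¹ I (bar sigma)) (symInterpolation lam)) := by
    refine Polynomial.funext fun u => ?_
    have := shiftSum_bar lam sigma u
    simp only [shiftSum, shiftTerm_bar] at this
    simp only [Polynomial.eval_mul, Polynomial.eval_C, Polynomial.eval_prod, Polynomial.eval_add,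
      Polynomial.eval_one, Polynomial.eval_X, Polynomial.eval_finsetSum, this]
    ring
  have := congrArg (fun p => Polynomial.coeff p r) h
  simp only [Polynomial.coeff_C_mul, Polynomial.finsetSum_coeff, Polynomial.coeff_mul_C,
    coeff_prod_one_add_X_mul] at this
  rw [← this]
  ring

/-! ### Values of `R_λ` relative to a rectangle. -/

/-- Everything in `I \ J` lies below the minimum of `J \ I`, and `I \ J` is no larger than `J \ I`.
The weight `i + 1` rather than `i` keeps the inequality strict when only index `0` is dropped. -/
theorem sum_lt_sum_of_isUpperSet {n : ℕ} {I J : Finset (Fin n)} (hJ : IsUpperSet (J : Set (Fin n)))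
    (hcard : I.card ≤ J.card) (hne : I ≠ J) :
    ∑ i ∈ I, (i.val + 1) < ∑ i ∈ J, (i.val + 1) := by
  rw [← Finset.sum_sdiff_lt_sum_sdiff]
  have hc := Finset.card_sdiff_le_card_sdiff_iff.2 hcard
  have hnonempty : (J \ I).Nonempty := by
    rw [Finset.nonempty_iff_ne_empty]
    intro h
    rw [h, Finset.card_empty, Nat.le_zero, Finset.card_eq_zero] at hc
    exact hne (Finset.Subset.antisymm (Finset.sdiff_eq_empty_iff_subset.1 hc)
      (Finset.sdiff_eq_empty_iff_subset.1 h))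
  set j := (J \ I).min' hnonempty
  have hj : j ∈ J := (Finset.mem_sdiff.1 ((J \ I).min'_mem hnonempty)).1
  have h1 : ∑ i ∈ I \ J, (i.val + 1) ≤ (I \ J).card • j.val := by
    refine Finset.sum_le_card_nsmul _ _ _ fun i hi => Nat.succ_le_of_lt ?_
    by_contra hij
    exact (Finset.mem_sdiff.1 hi).2 (hJ (Fin.le_def.2 (not_lt.1 hij)) hj)
  have h2 : (J \ I).card • (j.val + 1) ≤ ∑ i ∈ J \ I, (i.val + 1) := by
    refine Finset.card_nsmul_le_sum _ _ _ fun i hi => Nat.succ_le_succ ?_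
    exact Fin.le_def.1 ((J \ I).min'_le i hi)
  have h3 := Finset.card_pos.2 hnonempty
  have h4 : (I \ J).card • j.val ≤ (J \ I).card • j.val := Nat.mul_le_mul_right _ hc
  simp only [smul_eq_mul, mul_add, mul_one] at *
  lia

/-- The partition with `n` parts equal to `N`. -/
def Partitions.rect (n N : ℕ) : Partitions n := ⟨fun _ => N, fun _ _ _ => le_rfl⟩

/-- The complement of `μ` in the rectangle with `n` rows of length `N`. -/
def Partitions.compl {n : ℕ} (N : ℕ) (mu : Partitions n) : Partitions n :=
  ⟨fun i => N - mu.1 i.rev, fun _ _ h => Nat.sub_le_sub_left (mu.2 (Fin.rev_le_rev.2 h)) N⟩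

theorem Partitions.size_rect (n N : ℕ) : (rect n N).size = n * N := by
  simp [size, rect]

theorem Partitions.size_compl {n N : ℕ} {mu : Partitions n} (h : ∀ i, mu.1 i ≤ N) :
    (mu.compl N).size + mu.size = n * N := by
  have : ∑ i : Fin n, mu.1 i = ∑ i : Fin n, mu.1 i.rev := (Equiv.sum_comp Fin.revPerm mu.1).symm
  rw [size, size, this, ← Finset.sum_add_distrib]
  simp [compl, Nat.sub_add_cancel (h _)]

theorem Partitions.compl_compl {n N : ℕ} {mu : Partitions n} (h : ∀ i, mu.1 i ≤ N) :
    (mu.compl N).compl N = mu := by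
  refine Subtype.ext (funext fun i => ?_)
  simp [compl, Nat.sub_sub_self (h i)]

theorem Partitions.apply_le_size {n : ℕ} (mu : Partitions n) (i : Fin n) : mu.1 i ≤ mu.size :=
  Finset.single_le_sum (fun _ _ => Nat.zero_le _) (Finset.mem_univ i)

/-- The weight governing the induction in `exists_dual`. -/
def Partitions.coweight {n : ℕ} (N : ℕ) (mu : Partitions n) : ℕ :=
  ∑ i, (i.val + 1) * (N - mu.1 i)

theorem Partitions.AddOn.coweight {n N : ℕ} {nu sigma : Partitions n} {I : Finset (Fin n)}
    (h : nu.AddOn I sigma) (hN : ∀ i, sigma.1 i ≤ N) :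
    nu.coweight N = sigma.coweight N + ∑ i ∈ I, (i.val + 1) := by
  rw [Partitions.coweight, Partitions.coweight, ← Finset.univ_inter I, ← Finset.filter_mem_eq_inter,
    Finset.sum_filter, ← Finset.sum_add_distrib]
  refine Finset.sum_congr rfl fun i _ => ?_
  have h1 := h i
  have h2 := hN i
  split_ifs at h1 ⊢
  · rw [← Nat.mul_succ]
    congr 1
    lia
  · rw [h1, add_zero, add_zero]

/-- Parts with index in `I` are positive in `σ`, so no factor `t^(n-1) bar σ_i - 1` vanishes. As `I`
is an upper set, the exponents of `t` in the Vandermonde nodes strictly decrease. -/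
theorem coeff_shiftPoly_card_ne_zero {n : ℕ} {nu sigma : Partitions n} {I : Finset (Fin n)}
    (h : nu.AddOn I sigma) (hI : IsUpperSet (I : Set (Fin n))) :
    (shiftPoly sigma I).coeff I.card ≠ 0 := by
  rw [coeff_shiftPoly_card]
  refine mul_ne_zero (mul_ne_zero (Finset.prod_ne_zero_iff.2 fun i hi h0 => ?_)
    (Finset.prod_ne_zero_iff.2 fun i _ => bar_ne_zero sigma i))
    (Matrix.det_vandermonde_ne_zero_iff.2 fun i j hij => ?_)
  · have h1 : q ^ (sigma.1 i : ℤ) * t ^ (((n - 1 : ℕ) : ℤ) + -(i.val : ℤ)) =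
        q ^ (0 : ℤ) * t ^ (0 : ℤ) := by
      rw [zpow_add₀ t_ne_zero, zpow_natCast t, zpow_zero, zpow_zero]
      rw [bar_eq] at h0
      linear_combination h0
    have h2 := (q_zpow_mul_t_zpow_inj h1).1
    have h3 := h i
    rw [if_pos hi] at h3
    lia
  · have hexp : ∀ i, scaleOn t⁻¹ I (bar sigma) i =
        q ^ (sigma.1 i : ℤ) * t ^ (-(i.val : ℤ) - if i ∈ I then 1 else 0) := by
      intro i
      rw [scaleOn, bar_eq]
      split_ifs
      · rw [smul_eq_mul, zpow_sub_one₀ t_ne_zero]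
        ring
      · simp
    rw [hexp, hexp] at hij
    have h2 := (q_zpow_mul_t_zpow_inj hij).2
    rcases lt_trichotomy i j with hlt | heq | hlt
    · have hmem : i ∈ I → j ∈ I := fun hi => hI hlt.le hi
      split_ifs at h2 <;> grind
    · exact heq
    · have hmem : j ∈ I → i ∈ I := fun hj => hI hlt.le hj
      split_ifs at h2 <;> grind

/-- The values of all `R_λ` at `bar ρ`, relative to those at the rectangle with rows of length
`N`, are given by a single symmetric polynomial in the inverses of `bar λ`. -/
theorem exists_dual {n : ℕ} (N : ℕ) (rho : Partitions n) (hrho : ∀ i, rho.1 i ≤ N) :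
    ∃ P : MvPolynomial (Fin n) BaseField, P.IsSymmetric ∧ P.totalDegree + rho.size ≤ n * N ∧
      ∀ lam : Partitions n, eval (bar rho) (symInterpolation lam) =
        eval (bar (Partitions.rect n N)) (symInterpolation lam) *
          eval (fun i => (bar lam i)⁻¹) P := by
  induction hm : rho.coweight N using Nat.strong_induction_on generalizing rho with
  | h m ih =>
    subst hm
    by_cases hall : ∀ i, rho.1 i = N
    · have : rho = Partitions.rect n N := Subtype.ext (funext hall)
      subst this
      exact ⟨1, IsSymmetric.one, by simp [Partitions.size_rect], by simp⟩
    push Not at hall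
    obtain ⟨k, hk⟩ := hall
    -- Raise every part below `N` by one. The degree `|J|` part of the eigenvalue equation at `σ = ρ
    -- + 1_J` then contains `R_λ(bar ρ)` as its term `I = J`.
    set J : Finset (Fin n) := Finset.univ.filter fun i => rho.1 i < N
    have hJmem : ∀ i, i ∈ J ↔ rho.1 i < N := fun i => by simp [J]
    have hJ : IsUpperSet (J : Set (Fin n)) := by
      intro i j hij hi
      rw [Finset.mem_coe, hJmem] at hi ⊢
      exact (rho.2 hij).trans_lt hi
    have hkJ : k ∈ J := (hJmem k).2 (lt_of_le_of_ne (hrho k) hk)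
    let sigma : Partitions n := ⟨fun i => rho.1 i + if i ∈ J then 1 else 0, fun i j hij => by
      have h1 := rho.2 hij
      have h2 := hrho i
      have h3 := hrho j
      simp only [hJmem]
      split_ifs <;> lia⟩
    have hadd : rho.AddOn J sigma := fun i => rfl
    have hsigma : ∀ i, sigma.1 i ≤ N := fun i => by
      have h2 := hrho i
      simp only [sigma, hJmem]
      split_ifs <;> lia
    have hw := hadd.coweight hsigma
    have hJpos : 0 < ∑ i ∈ J, (i.val + 1) :=
      Finset.sum_pos (fun i _ => Nat.succ_pos _) ⟨k, hkJ⟩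
    obtain ⟨P₁, hP₁s, hP₁d, hP₁⟩ := ih _ (by lia) sigma hsigma rfl
    have hsize := hadd.size
    -- The other terms have `|I| ≤ |J|`, so they belong to `σ - 1_I` of smaller coweight than `ρ`
    -- and of size at least `|ρ|`: the induction applies and the degree bound survives.
    have hQ : ∀ I : Finset (Fin n), I ≠ J → ∃ Q : MvPolynomial (Fin n) BaseField,
        Q.IsSymmetric ∧ Q.totalDegree + rho.size ≤ n * N ∧ ∀ lam : Partitions n,
          (shiftPoly sigma I).coeff J.card *
            eval (scaleOn q⁻¹ I (bar sigma)) (symInterpolation lam) =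
          eval (bar (Partitions.rect n N)) (symInterpolation lam) *
            eval (fun i => (bar lam i)⁻¹) Q := by
      intro I hI
      by_cases h0 : (shiftPoly sigma I).coeff J.card = 0
      · exact ⟨0, IsSymmetric.zero, by simp; lia, by simp [h0]⟩
      have hcard : I.card ≤ J.card := by
        by_contra h
        exact h0 (coeff_shiftPoly_of_lt sigma (not_le.1 h))
      obtain ⟨nu, hnu⟩ := (exists_addOn_or_shiftPoly_eq_zero sigma I).resolve_right
        fun h => h0 (by rw [h, Polynomial.coeff_zero])
      have hlt := sum_lt_sum_of_isUpperSet hJ hcard hI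
      have hw' := hnu.coweight hsigma
      have hsize' := hnu.size
      obtain ⟨P, hPs, hPd, hP⟩ := ih _ (by lia) nu (fun i => by
        have h1 := hnu i
        have h2 := hsigma i
        lia) rfl
      refine ⟨(shiftPoly sigma I).coeff J.card • P, hPs.smul _, ?_, fun lam => ?_⟩
      · have := totalDegree_smul_le ((shiftPoly sigma I).coeff J.card) P
        lia
      · rw [hnu.scaleOn_bar, hP, smul_eval]
        ring
    choose! Q hQs hQd hQ using hQ
    have hc := coeff_shiftPoly_card_ne_zero hadd hJ
    set c := (shiftPoly sigma J).coeff J.card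
    set A := (∏ i, bar sigma i) * (Matrix.vandermonde (bar sigma)).det
    -- The equation solved for the term `I = J`; multiplying by `e_|J|` costs exactly the degree
    -- `|σ| - |ρ|`.
    refine ⟨c⁻¹ • (A • (esymm (Fin n) BaseField J.card * P₁) - ∑ I ∈ Finset.univ.erase J, Q I),
      ?_, ?_, fun lam => ?_⟩
    · refine IsSymmetric.smul _ (IsSymmetric.sub (IsSymmetric.smul _
        ((esymm_isSymmetric _ _ _).mul hP₁s)) ?_)
      rw [← mem_symmetricSubalgebra]
      exact sum_mem fun I hI => hQs I (Finset.ne_of_mem_erase hI)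
    · have hle : rho.size ≤ n * N := by lia
      refine Nat.add_le_of_le_sub hle ?_
      refine (totalDegree_smul_le _ _).trans ((totalDegree_sub _ _).trans (max_le ?_ ?_))
      · refine (totalDegree_smul_le _ _).trans ((totalDegree_mul _ _).trans ?_)
        have := totalDegree_esymm_le (F := BaseField) n J.card
        lia
      · refine totalDegree_finsetSum_le fun I hI => ?_
        have := hQd I (Finset.ne_of_mem_erase hI)
        lia
    · have h := esymm_mul_eval_symInterpolation lam sigma J.card
      rw [← Finset.add_sum_erase _ _ (Finset.mem_univ J), hadd.scaleOn_bar,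
        Finset.sum_congr rfl fun I hI => hQ I (Finset.ne_of_mem_erase hI) lam,
        ← Finset.mul_sum, hP₁] at h
      rw [smul_eval, map_sub, smul_eval, map_mul, map_sum]
      change A * _ = c * _ + _ at h
      rw [mul_left_comm, eq_inv_mul_iff_mul_eq₀ hc]
      linear_combination -h

/-- The nonzero value `R_λ(bar λ)` is a multiple of the value at the rectangle. -/
theorem eval_rect_symInterpolation_ne_zero {n N : ℕ} {lam : Partitions n}
    (h : ∀ i, lam.1 i ≤ N) :
    eval (bar (Partitions.rect n N)) (symInterpolation lam) ≠ 0 := by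
  obtain ⟨P, -, -, hP⟩ := exists_dual N lam h
  exact left_ne_zero_of_mul (hP lam ▸ eval_symInterpolation_self_ne_zero lam)

/-! ### Duality at `a = q^N` by complementation. -/

theorem bar_compl {n N : ℕ} {mu : Partitions n} (h : ∀ i, mu.1 i ≤ N) (i : Fin n) :
    bar (mu.compl N) i = q ^ N * tilde mu i := by
  rw [bar_eq, tilde, tau, ← mul_assoc, ← zpow_natCast q N, ← zpow_add₀ q_ne_zero]
  congr 2
  have := h i.rev
  simp only [Partitions.compl]
  lia

theorem tilde_eq {n : ℕ} (mu : Partitions n) (i : Fin n) :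
    tilde mu i = t ^ (1 - (n : ℤ)) * (bar mu i.rev)⁻¹ := by
  rw [tilde, tau, bar_eq, mul_inv, ← zpow_neg, ← zpow_neg, mul_left_comm, ← zpow_add₀ t_ne_zero]
  congr 2
  have := i.isLt
  rw [Fin.val_rev]
  lia

/-- Duality at `a = q ^ N`. -/
theorem duality_rect {n N : ℕ} {lam mu : Partitions n} (hlam : ∀ i, lam.1 i ≤ N)
    (hmu : mu.size ≤ N) :
    eval (bar (mu.compl N)) (symInterpolation lam) *
        eval (bar (Partitions.rect n N)) (symInterpolation mu) =
      eval (bar (lam.compl N)) (symInterpolation mu) *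
        eval (bar (Partitions.rect n N)) (symInterpolation lam) := by
  have hmuN : ∀ i, mu.1 i ≤ N := fun i => (mu.apply_le_size i).trans hmu
  obtain ⟨P, hPs, hPd, hP⟩ := exists_dual N (mu.compl N) fun i => Nat.sub_le _ _
  have hmuc := Partitions.size_compl hmuN
  -- The inverse of `bar` of the complement of `κ` is `z • bar κ` in reversed order.
  set z : BaseField := (q ^ N)⁻¹ * t ^ ((n : ℤ) - 1)
  let Q : MvPolynomial (Fin n) BaseField := aeval (fun i => z • X i) P
  have hQs : Q.IsSymmetric := by
    intro e
    change rename e (aeval _ P) = _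
    rw [← AlgHom.comp_apply, comp_aeval]
    simp only [map_smul, rename_X]
    exact aeval_comp_perm hPs e fun i => (z • X i : MvPolynomial (Fin n) BaseField)
  have hQd : Q.totalDegree ≤ mu.size := by
    refine (totalDegree_aeval_le _ (fun i => (totalDegree_smul_le _ _).trans (by simp)) P).trans ?_
    lia
  have hQ : ∀ kappa : Partitions n, (∀ i, kappa.1 i ≤ N) →
      eval (bar (mu.compl N)) (symInterpolation (kappa.compl N)) =
        eval (bar (Partitions.rect n N)) (symInterpolation (kappa.compl N)) *
          eval (bar kappa) Q := by
    intro kappa hk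
    rw [hP]
    congr 1
    have h1 : eval (bar kappa) Q = aeval (fun i => z * bar kappa i) P := by
      rw [← aeval_eq_eval]
      change aeval _ (aeval _ P) = _
      rw [← AlgHom.comp_apply, comp_aeval]
      simp
    rw [h1, ← aeval_comp_perm hPs Fin.revPerm, aeval_eq_eval]
    congr 2
    funext i
    rw [bar_compl hk, tilde_eq, mul_inv, mul_inv, inv_inv, ← zpow_neg, neg_sub, mul_assoc]
    rfl
  -- If `|κ| ≤ |μ|` and `κ ≠ μ`, the complement of `μ` is no larger than that of `κ` and differs
  -- from it, so the interpolation polynomial of the latter vanishes there.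
  have hQR := eq_smul_symInterpolation mu hQs hQd fun kappa hk hne => by
    have hkN : ∀ i, kappa.1 i ≤ N := fun i => (kappa.apply_le_size i).trans (hk.trans hmu)
    have h1 := hQ kappa hkN
    have hkc := Partitions.size_compl hkN
    rw [(isSymInterpolation_symInterpolation _).vanishing _ (by lia) fun h => hne ?_] at h1
    · exact (mul_eq_zero.1 h1.symm).resolve_left
        (eval_rect_symInterpolation_ne_zero fun i => Nat.sub_le _ _)
    · rw [← Partitions.compl_compl hkN, ← h, Partitions.compl_compl hmuN]
  set r := eval (bar mu) Q / eval (bar mu) (symInterpolation mu)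
  have h1 := hQ (lam.compl N) fun i => Nat.sub_le _ _
  rw [Partitions.compl_compl hlam, hQR, smul_eval] at h1
  -- The complement of the rectangle is the zero partition, with polynomial `1`; this determines the
  -- constant `r`.
  have h2 := hQ (Partitions.rect n N) fun i => le_rfl
  have hone : symInterpolation ((Partitions.rect n N).compl N) = 1 := by
    have hR := isSymInterpolation_symInterpolation ((Partitions.rect n N).compl N)
    have h0 : ∀ i, ((Partitions.rect n N).compl N).1 i = 0 := fun i => by
      simp [Partitions.compl, Partitions.rect]
    have hd := hR.degree_le
    rw [Partitions.size, Finset.sum_eq_zero fun i _ => h0 i, Nat.le_zero,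
      totalDegree_eq_zero_iff_eq_C] at hd
    have hc := hR.coeff_eq_one
    rw [show Finsupp.equivFunOnFinite.symm ((Partitions.rect n N).compl N).1 = 0 from
      Finsupp.ext h0] at hc
    rw [hd, hc, map_one]
  rw [hone, map_one, map_one, one_mul, hQR, smul_eval] at h2
  rw [h1]
  linear_combination -(eval (bar (Partitions.rect n N)) (symInterpolation lam) *
    eval (bar (lam.compl N)) (symInterpolation mu)) * h2

/-! ### From `a = q^N` to generic `a`. -/

/-- The restriction of `f` to the line spanned by `y`. -/
noncomputable def onLine {n : ℕ} (y : Fin n → BaseField) (f : MvPolynomial (Fin n) BaseField) :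
    Polynomial BaseField :=
  aeval (fun i => Polynomial.X * Polynomial.C (y i)) f

theorem eval_onLine {n : ℕ} (y : Fin n → BaseField) (f : MvPolynomial (Fin n) BaseField)
    (r : BaseField) : (onLine y f).eval r = eval (fun i => r * y i) f := by
  rw [onLine, ← Polynomial.coe_aeval_eq_eval, ← AlgHom.comp_apply, comp_aeval, aeval_eq_eval]
  congr 2
  funext i
  rw [map_mul, Polynomial.aeval_X, Polynomial.aeval_C, Algebra.algebraMap_self, RingHom.id_apply]

theorem eval_scaleA {n : ℕ} (y : Fin n → BaseField) (lam : Partitions n) :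
    eval (scaleA y) (symInterpolationK lam) =
      algebraMap (Polynomial BaseField) BigField (onLine y (symInterpolation lam)) := by
  rw [symInterpolationK, eval_map, onLine, ← IsScalarTower.coe_toAlgHom' BaseField,
    ← AlgHom.comp_apply, comp_aeval, aeval_def]
  congr 1
  funext i
  rw [scaleA, a, RatFunc.algebraMap_eq_C]
  simp only [IsScalarTower.coe_toAlgHom', map_mul, RatFunc.algebraMap_X, RatFunc.algebraMap_C]

theorem q_pow_injective : Function.Injective fun N : ℕ => q ^ N := fun N N' h =>
  (q_pow_mul_t_pow_inj (l := 0) (l' := 0) (by simpa using h)).1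

theorem eval_onLine_tau {n : ℕ} (lam : Partitions n) (N : ℕ) :
    (onLine tau (symInterpolation lam)).eval (q ^ N) =
      eval (bar (Partitions.rect n N)) (symInterpolation lam) := by
  rw [eval_onLine]
  rfl

theorem onLine_tau_ne_zero {n : ℕ} (lam : Partitions n) :
    onLine tau (symInterpolation lam) ≠ 0 := by
  intro h
  refine eval_rect_symInterpolation_ne_zero (N := lam.size) lam.apply_le_size ?_
  rw [← eval_onLine_tau, h, Polynomial.eval_zero]

/-- Two polynomials in `a` that agree at `q^N` for all `N ≥ |λ| + |μ|`, infinitely many points since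
`q` is not a root of unity. -/
theorem onLine_tilde_mul {n : ℕ} (lam mu : Partitions n) :
    onLine (tilde mu) (symInterpolation lam) * onLine tau (symInterpolation mu) =
      onLine (tilde lam) (symInterpolation mu) * onLine tau (symInterpolation lam) := by
  refine Polynomial.eq_of_infinite_eval_eq _ _ (Set.Infinite.mono ?_
    ((Set.Ici_infinite (lam.size + mu.size)).image q_pow_injective.injOn))
  rintro _ ⟨N, hN, rfl⟩
  have hN : lam.size + mu.size ≤ N := hN
  have hl : ∀ i, lam.1 i ≤ N := fun i => (lam.apply_le_size i).trans (by lia)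
  have hm : ∀ i, mu.1 i ≤ N := fun i => (mu.apply_le_size i).trans (by lia)
  have := duality_rect hl (mu := mu) (by lia)
  rw [Set.mem_ofPred_eq, Polynomial.eval_mul, Polynomial.eval_mul, eval_onLine_tau, eval_onLine_tau,
    eval_onLine, eval_onLine]
  simpa only [← bar_compl hl, ← bar_compl hm] using this

theorem eval_scaleA_tau_ne_zero {n : ℕ} (lam : Partitions n) :
    eval (scaleA tau) (symInterpolationK lam) ≠ 0 := by
  rw [eval_scaleA]
  exact RatFunc.algebraMap_ne_zero (onLine_tau_ne_zero lam)

theorem eval_Kplus {n : ℕ} (lam : Partitions n) (x : Fin n → BigField) :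
    eval x (Kplus lam) =
      (eval (scaleA tau) (symInterpolationK lam))⁻¹ * eval x (symInterpolationK lam) := by
  rw [Kplus, map_mul, eval_C]

theorem duality_tilde {n : ℕ} (lam mu : Partitions n) :
    eval (scaleA (tilde mu)) (Kplus lam) = eval (scaleA (tilde lam)) (Kplus mu) := by
  rw [eval_Kplus, eval_Kplus, inv_mul_eq_iff_eq_mul₀ (eval_scaleA_tau_ne_zero lam), mul_left_comm,
    eq_inv_mul_iff_mul_eq₀ (eval_scaleA_tau_ne_zero mu)]
  simp only [eval_scaleA, ← map_mul]
  rw [mul_comm, onLine_tilde_mul, mul_comm]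

/-- The two points differ by reversing coordinates, which a symmetric polynomial does not see. -/
theorem eval_scaleA_bar_inv {n : ℕ} (lam mu : Partitions n) :
    eval (scaleA fun i => t ^ (1 - (n : ℤ)) * (bar mu i)⁻¹) (Kplus lam) =
      eval (scaleA (tilde mu)) (Kplus lam) := by
  have hs : (symInterpolationK lam).IsSymmetric :=
    (isSymInterpolation_symInterpolation lam).symmetric.map _
  have h := aeval_comp_perm hs Fin.revPerm
    (scaleA fun i => t ^ (1 - (n : ℤ)) * (bar mu i)⁻¹)
  rw [aeval_eq_eval, aeval_eq_eval] at h
  rw [eval_Kplus, eval_Kplus, ← h]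
  congr 3
  funext i
  rw [scaleA, scaleA, tilde_eq, Fin.revPerm_apply]

end InterpolationMacdonald

theorem mainTheorem4 (n : ℕ) :
    (∀ lam : InterpolationMacdonald.Partitions n,
      (∃! R : MvPolynomial (Fin n) InterpolationMacdonald.BaseField,
        InterpolationMacdonald.IsSymInterpolation lam R) ∧
      MvPolynomial.eval (InterpolationMacdonald.scaleA InterpolationMacdonald.tau)
        (InterpolationMacdonald.symInterpolationK lam) ≠ 0) ∧
    (∀ lam mu : InterpolationMacdonald.Partitions n,
      MvPolynomial.eval
          (InterpolationMacdonald.scaleA (InterpolationMacdonald.tilde mu))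
          (InterpolationMacdonald.Kplus lam) =
        MvPolynomial.eval
          (InterpolationMacdonald.scaleA (InterpolationMacdonald.tilde lam))
          (InterpolationMacdonald.Kplus mu) ∧
      MvPolynomial.eval
          (InterpolationMacdonald.scaleA fun i =>
            InterpolationMacdonald.t ^ (1 - (n : ℤ)) * (InterpolationMacdonald.bar mu i)⁻¹)
          (InterpolationMacdonald.Kplus lam) =
        MvPolynomial.eval
          (InterpolationMacdonald.scaleA fun i =>
            InterpolationMacdonald.t ^ (1 - (n : ℤ)) * (InterpolationMacdonald.bar lam i)⁻¹)
          (InterpolationMacdonald.Kplus mu)) := by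
  refine ⟨fun lam => ⟨InterpolationMacdonald.existsUnique_isSymInterpolation lam,
    InterpolationMacdonald.eval_scaleA_tau_ne_zero lam⟩, fun lam mu =>
    ⟨InterpolationMacdonald.duality_tilde lam mu, ?_⟩⟩
  rw [InterpolationMacdonald.eval_scaleA_bar_inv, InterpolationMacdonald.eval_scaleA_bar_inv]
  exact InterpolationMacdonald.duality_tilde lam mu
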